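/- Let $F$ be a field and let $r,n\ge 0$ be integers. For an $r$-element subset $I\subseteq[n]=\{1,\dots,n\}$ and an $r\times n$ matrix $A$ let $p_I(A)=\det A_I$, where $A_I$ consists of the columns of $A$ indexed by $I$ in increasing order. Let $\mathsf{Gr}(r,n;F)$ be the Grassmannian, regarded as a scheme: the reduced closed subscheme of $\operatorname{Proj} F[p_I : I\in\binom{[n]}{r}]$ cut out by all homogeneous polynomial relations over $F$ among the maximal minors of the generic $r\times n$ matrix. A rank $r$ matrix $A\in K^{r\times n}$ over an extension field $K$ of $F$ gives a point $[A]$ of $\mathsf{Gr}(r,n;F)$, with homogeneous coordinates $p_I(A)$; it depends only on the row span of $A$. Write $A_i$ for the $i$-th column of $A$, and let $$\mathsf{Gr}^{\mathsf{dc}}(r,n;F)=\{[A] : A_1,\dots,A_n \text{ are pairwise distinct and nonzero}\},\qquad S_{ij}=\{[A] : A_i=A_j\},\qquad S_i=\{[A] : A_i=0\},$$ where $A$ runs over the rank $r$ matrices over all extension fields of $F$. For a tuple $c=(c_1,\dots,c_r)\in[n]^r$ let $p_{c}=0$ if the $c_k$ are not distinct, and $p_c=\operatorname{sgn}(\sigma)\,p_{\{c_1,\dots,c_r\}}$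 otherwise, where $\sigma$ is the permutation that sorts $c$ increasingly. By an $F$-variety we mean a reduced separated $F$-scheme of finite type. Then: 1. $\mathsf{Gr}(r,n;F)$ is an $F$-variety, and $\mathsf{Gr}^{\mathsf{dc}}(r,n;F)$ is an open subvariety of it, i.e. a Zariski-open subset which, as an open subscheme, is an $F$-variety. 2. The complement of $\mathsf{Gr}^{\mathsf{dc}}(r,n;F)$ in $\mathsf{Gr}(r,n;F)$ is $\bigcup_{i\ne j}S_{ij}\cup\bigcup_i S_i$. 3. For all $i\neq j$ the set $S_{ij}$ is closed in $\mathsf{Gr}(r,n;F)$; it is cut out by the equations $p_{(c_1,\dots,c_{k-1},i,c_{k+1},\dots,c_r)}=p_{(c_1,\dots,c_{k-1},j,c_{k+1},\dots,c_r)}$ for all $c\in[n]^r$ and $1\le k\le r$. 4. For all $i$ the set $S_i$ is closed in $\mathsf{Gr}(r,n;F)$; it is cut out by the equations $p_I=0$ for all $I\in\binom{[n]}{r}$ with $i\in I$. 5. Membership does not depend on the representing matrix: for every rank $r$ matrix $A\in K^{r\times n}$ over any extension field $K$ of $F$, $[A]\in\mathsf{Gr}^{\mathsf{dc}}(r,n;F)$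 if and only if the columns of $A$ are pairwise distinct and nonzero; $[A]\in S_{ij}$ if and only if $A_i=A_j$ (for $i\ne j$); and $[A]\in S_i$ if and only if $A_i=0$. -/

import Mathlib

open AlgebraicGeometry CategoryTheory MvPolynomial

universe u v

namespace DCGrass

/-- The index set `([n] choose r)` of `r`-element subsets of `[n]`. -/
abbrev Idx (r n : ℕ) : Type := {I : Finset (Fin n) // I.card = r}

/-- The maximal minor `det A_I` of an `r × n` matrix, the columns in `I` being taken in
increasing order. -/
def minor {R : Type*} [CommRing R] {r n : ℕ} (A : Matrix (Fin r) (Fin n) R) (I : Idx r n) : R :=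
  (A.submatrix id (I.1.orderEmbOfFin I.2)).det

/-- An `r × n` matrix of rank `r` over a field has a nonzero maximal minor. -/
theorem exists_minor_ne_zero {K : Type*} [Field K] {r n : ℕ} (A : Matrix (Fin r) (Fin n) K)
    (hA : A.rank = r) : ∃ I : Idx r n, minor A I ≠ 0 := by
  obtain ⟨κ, a, ha, hspan, hli⟩ := exists_linearIndependent' K A.col
  have : Finite κ := Finite.of_injective a ha
  have := Fintype.ofFinite κ
  have hcard : Fintype.card κ = r := by
    rw [← finrank_span_eq_card hli, hspan, ← Matrix.rank_eq_finrank_span_cols, hA]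
  have hI : (Finset.univ.image a).card = r := by
    rw [Finset.card_image_of_injective _ ha]; simpa
  refine ⟨⟨Finset.univ.image a, hI⟩, ?_⟩
  set e := (Finset.univ.image a).orderEmbOfFin hI
  have h : ∀ k, ∃ l, a l = e k := fun k => by
    obtain ⟨l, -, hl⟩ := Finset.mem_image.1 (Finset.orderEmbOfFin_mem (Finset.univ.image a) hI k)
    exact ⟨l, hl⟩
  choose g hg using h
  have hginj : Function.Injective g := fun x y hxy =>
    e.injective (by rw [← hg, ← hg, hxy])
  have heq : (A.submatrix id e).col = (A.col ∘ a) ∘ g := by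
    ext k i
    simp [hg]
  have hli' : LinearIndependent K (A.submatrix id e).col := heq ▸ hli.comp g hginj
  rw [Matrix.linearIndependent_cols_iff_isUnit, Matrix.isUnit_iff_isUnit_det] at hli'
  exact hli'.ne_zero

section Projective

variable (F : Type u) [Field F] (r n : ℕ)

/-- The polynomial ring `F[p_I : I ∈ ([n] choose r)]` in the Plücker coordinates. -/
abbrev PluckerRing : Type u := MvPolynomial (Idx r n) F

/-- Its standard grading by degree. -/
noncomputable abbrev pluckerGrading : ℕ → Submodule F (PluckerRing F r n) :=
  homogeneousSubmodule (Idx r n) F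

noncomputable instance pluckerGradedAlgebra : GradedAlgebra (pluckerGrading F r n) := gradedAlgebra

/-- The ambient projective space with homogeneous coordinates `p_I`, as a scheme. -/
noncomputable abbrev pluckerSpace : Scheme.{u} := Proj (pluckerGrading F r n)

/-- The structure morphism of the ambient projective space. -/
noncomputable def pluckerSpaceToSpec : pluckerSpace F r n ⟶ Spec (.of F) :=
  Proj.toSpecZero (pluckerGrading F r n) ≫
    Spec.map (CommRingCat.ofHom (algebraMap F (pluckerGrading F r n 0)))

/-- The generic `r × n` matrix, with entries the variables `x_{ki}`. -/
noncomputable def genericMatrix : Matrix (Fin r) (Fin n) (MvPolynomial (Fin r × Fin n) F) :=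
  Matrix.of fun k i => X (k, i)

/-- The homogeneous forms in the `p_I` that are relations between the maximal minors of the generic
matrix. They are the homogeneous elements of the Plücker ideal, the homogeneous ideal
of the Grassmannian. -/
def pluckerRelations : Set (PluckerRing F r n) :=
  {f | (∃ d, f ∈ pluckerGrading F r n d) ∧ aeval (minor (genericMatrix F r n)) f = 0}

/-- The closed subset of projective space cut out by the Plücker relations. -/
noncomputable def grassmannianClosed : TopologicalSpace.Closeds (pluckerSpace F r n) :=
  ⟨ProjectiveSpectrum.zeroLocus (pluckerGrading F r n) (pluckerRelations F r n),
    ProjectiveSpectrum.isClosed_zeroLocus _ _⟩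

/-- The Grassmannian `Gr(r,n;F)`, as a scheme: the reduced closed subscheme of projective space
cut out by the Plücker relations. -/
noncomputable def Gr : Scheme.{u} :=
  (Scheme.IdealSheafData.vanishingIdeal (grassmannianClosed F r n)).subscheme

/-- The Plücker embedding of the Grassmannian. -/
noncomputable def pluckerEmbedding : Gr F r n ⟶ pluckerSpace F r n :=
  (Scheme.IdealSheafData.vanishingIdeal (grassmannianClosed F r n)).subschemeι

/-- The structure morphism of the Grassmannian. -/
noncomputable def grToSpec : Gr F r n ⟶ Spec (.of F) :=
  pluckerEmbedding F r n ≫ pluckerSpaceToSpec F r n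

/-- The subset of the Grassmannian cut out by a set of equations in the Plücker coordinates. -/
def pluckerZeroLocus (s : Set (PluckerRing F r n)) : Set (Gr F r n) :=
  pluckerEmbedding F r n ⁻¹' ProjectiveSpectrum.zeroLocus (pluckerGrading F r n) s

/-- The coordinate `p_{c_1 ⋯ c_r}` of an arbitrary tuple of column indices, with the usual
alternating convention: it is zero when the `c_k` are not distinct, and otherwise it is
`± p_{{c_1, …, c_r}}`, the sign being that of the permutation that sorts the tuple. -/
noncomputable def pluckerTuple {r n : ℕ} (c : Fin r → Fin n) : PluckerRing F r n :=
  if h : Function.Injective c then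
    ((Equiv.Perm.sign (Tuple.sort c) : ℤˣ) : ℤ) •
      X ⟨Finset.univ.image c, by rw [Finset.card_image_of_injective _ h]; simp⟩
  else 0

end Projective

/-- A variety over `F` is a reduced, separated `F`-scheme of finite type. -/
structure IsVariety {F : Type u} [Field F] {X : Scheme.{u}} (f : X ⟶ Spec (.of F)) : Prop where
  reduced : IsReduced X
  separated : IsSeparated f
  locallyOfFiniteType : LocallyOfFiniteType f
  quasiCompact : QuasiCompact f

section Points

variable (F : Type u) [Field F] {r n : ℕ} {K : Type v} [Field K] [Algebra F K]

/-- The point of projective space whose homogeneous coordinates are the maximal minors of a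
rank `r` matrix `A` over an extension field of `F`: the prime generated by the forms over `F` that
vanish at the vector of maximal minors. -/
noncomputable def pluckerPoint (A : Matrix (Fin r) (Fin n) K) (hA : A.rank = r) :
    pluckerSpace F r n :=
  (⟨(RingHom.ker (aeval (R := F) (minor A))).homogeneousCore (pluckerGrading F r n),
    Ideal.IsPrime.homogeneousCore (RingHom.ker_isPrime _), by
      obtain ⟨I, hI⟩ := exists_minor_ne_zero A hA
      intro h
      have h1 : (X I : PluckerRing F r n) ∈
          HomogeneousIdeal.irrelevant (pluckerGrading F r n) :=
        HomogeneousIdeal.mem_irrelevant_of_mem _ one_pos (isHomogeneous_X F I)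
      have h2 := Ideal.toIdeal_homogeneousCore_le _ _ (h h1)
      exact hI (by simpa using h2)⟩ : ProjectiveSpectrum (pluckerGrading F r n))

/-- The minors of the generic matrix specialize to those of any matrix, so that every relation
between them holds at the point of a matrix, which hence lies on the Grassmannian. -/
theorem exists_grPoint (A : Matrix (Fin r) (Fin n) K) (hA : A.rank = r) :
    ∃ x : Gr F r n, pluckerEmbedding F r n x = pluckerPoint F A hA := by
  have hmem : pluckerPoint F A hA ∈ (grassmannianClosed F r n : Set (pluckerSpace F r n)) := by
    rintro f ⟨⟨d, hd⟩, hf⟩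
    refine Ideal.mem_homogeneousCore_of_homogeneous_of_mem ⟨d, hd⟩ ?_
    rw [RingHom.mem_ker]
    let φ : MvPolynomial (Fin r × Fin n) F →ₐ[F] K := aeval fun x => A x.1 x.2
    have hφ : ∀ I, φ (minor (genericMatrix F r n) I) = minor A I := fun I => by
      unfold minor
      rw [AlgHom.map_det]
      congr 1
      ext k i
      simp [φ, genericMatrix]
    have h : φ (aeval (minor (genericMatrix F r n)) f) = aeval (minor A) f := by
      rw [← AlgHom.comp_apply, comp_aeval]
      simp only [hφ]
    change aeval (minor A) f = 0
    rw [← h, hf, map_zero]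
  have hrange := (Scheme.IdealSheafData.vanishingIdeal (grassmannianClosed F r n)).range_subschemeι
  rw [Scheme.IdealSheafData.coe_support_vanishingIdeal] at hrange
  rw [← hrange] at hmem
  exact hmem

/-- The point of the Grassmannian given by the row span of a rank `r` matrix over an extension
field of `F`. -/
noncomputable def grPoint (A : Matrix (Fin r) (Fin n) K) (hA : A.rank = r) : Gr F r n :=
  (exists_grPoint F A hA).choose

theorem pluckerEmbedding_grPoint (A : Matrix (Fin r) (Fin n) K) (hA : A.rank = r) :
    pluckerEmbedding F r n (grPoint F A hA) = pluckerPoint F A hA :=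
  (exists_grPoint F A hA).choose_spec

end Points

section Loci

variable (F : Type u) [Field F] (r n : ℕ)

/-- The distinct column locus: the points of the Grassmannian represented by matrices whose columns
are pairwise distinct and nonzero. -/
def distinctColumnLocus : Set (Gr F r n) :=
  {x | ∃ (K : Type u) (_ : Field K) (_ : Algebra F K) (A : Matrix (Fin r) (Fin n) K)
    (hA : A.rank = r), (Function.Injective A.col ∧ ∀ i, A.col i ≠ 0) ∧ grPoint F A hA = x}

variable {n}

/-- The points represented by matrices whose `i`th and `j`th columns are equal. -/
def equalColumnLocus (i j : Fin n) : Set (Gr F r n) :=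
  {x | ∃ (K : Type u) (_ : Field K) (_ : Algebra F K) (A : Matrix (Fin r) (Fin n) K)
    (hA : A.rank = r), A.col i = A.col j ∧ grPoint F A hA = x}

/-- The points represented by matrices whose `i`th column is zero. -/
def zeroColumnLocus (i : Fin n) : Set (Gr F r n) :=
  {x | ∃ (K : Type u) (_ : Field K) (_ : Algebra F K) (A : Matrix (Fin r) (Fin n) K)
    (hA : A.rank = r), A.col i = 0 ∧ grPoint F A hA = x}

/-- The equations `p_{c_1 ⋯ i ⋯ c_r} = p_{c_1 ⋯ j ⋯ c_r}`, with `i`, `j` in the same position. -/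
def equalColumnEquations (i j : Fin n) : Set (PluckerRing F r n) :=
  {f | ∃ (c : Fin r → Fin n) (k : Fin r),
    f = pluckerTuple F (Function.update c k i) - pluckerTuple F (Function.update c k j)}

/-- The equations `p_I = 0` for `I` containing `i`. -/
def zeroColumnEquations (i : Fin n) : Set (PluckerRing F r n) :=
  {f | ∃ I : Idx r n, i ∈ I.1 ∧ f = X I}

end Loci

end DCGrass

/-! Everything reduces to linear algebra at one nonzero minor `p_I`. By Cramer's rule the numbers
`p_{I(k → j)}`, divided by `p_I`, are the coordinates of the column `A_j` in the basis `A_I`. So the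
linear equations `p_{c(k → i)} = p_{c(k → j)}` say exactly that `A_i = A_j`, and the vanishing of
every `p_I` with `i ∈ I` says that `A_i = 0` (`col_eq_col_iff`, `col_eq_zero_iff`).

To pass from matrices to scheme points, each point must come from a matrix (`exists_grPoint_eq`).
Its homogeneous prime gives coordinates in a fraction field that satisfy the Plücker relations, and
the same Cramer matrix, scaled by `1/p_I`, realizes them up to a scalar
(`exists_matrix_minor_eq_smul`). Hence the loci `S_ij` and `S_i` are zero loci of forms. This gives
closedness and independence of the representing matrix; the distinct column locus is the complement
of a finite union of closed sets. -/

namespace DCGrass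

/-! ### Minors, Cramer's rule and the columns of a matrix -/

section Minors

variable (F : Type u) [Field F] {r n : ℕ}

theorem orderEmbOfFin_image_eq_comp_sort {c : Fin r → Fin n} (h : Function.Injective c)
    (hI : (Finset.univ.image c).card = r) :
    ⇑((Finset.univ.image c).orderEmbOfFin hI) = c ∘ Tuple.sort c := by
  symm
  refine Finset.orderEmbOfFin_unique hI (fun x => ?_) ?_
  · exact Finset.mem_image_of_mem _ (Finset.mem_univ _)
  · exact (Tuple.monotone_sort c).strictMono_of_injective (h.comp (Tuple.sort c).injective)

/-- Evaluated at the maximal minors of `A`, the coordinate `p_c` is the determinant of the matrix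
with columns `A_{c_1}, …, A_{c_r}`. -/
theorem aeval_minor_pluckerTuple {R : Type*} [CommRing R] [Algebra F R]
    (A : Matrix (Fin r) (Fin n) R) (c : Fin r → Fin n) :
    aeval (minor A) (pluckerTuple F c) = (A.submatrix id c).det := by
  unfold pluckerTuple
  split_ifs with h
  · rw [map_zsmul, aeval_X, minor, orderEmbOfFin_image_eq_comp_sort h]
    have := Matrix.det_permute' (Tuple.sort c) (A.submatrix id c)
    rw [Matrix.submatrix_submatrix] at this
    rw [show (id ∘ id : Fin r → Fin r) = id from rfl] at this
    -- The sign in the convention for `p_c` cancels the sign produced by sorting the columns.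
    rw [this, zsmul_eq_mul, ← mul_assoc, ← Int.cast_mul, ← Units.val_mul, Int.units_mul_self]
    simp
  · simp only [Function.Injective, not_forall] at h
    obtain ⟨a, b, hab, hne⟩ := h
    rw [map_zero, Matrix.det_zero_of_column_eq hne fun k => by simp [hab]]

theorem isHomogeneous_pluckerTuple (c : Fin r → Fin n) :
    (pluckerTuple F c).IsHomogeneous 1 := by
  unfold pluckerTuple
  split_ifs
  · exact (homogeneousSubmodule _ F 1).toAddSubgroup.zsmul_mem (isHomogeneous_X F _) _
  · exact isHomogeneous_zero _ _ _

theorem isHomogeneous_det {σ : Type*} {m d : ℕ} {M : Matrix (Fin m) (Fin m) (MvPolynomial σ F)}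
    (hM : ∀ i j, (M i j).IsHomogeneous d) : M.det.IsHomogeneous (m * d) := by
  rw [Matrix.det_apply]
  refine IsHomogeneous.sum _ _ _ fun σ _ => ?_
  rw [Units.smul_def]
  refine (homogeneousSubmodule _ F _).toAddSubgroup.zsmul_mem ?_ _
  have := IsHomogeneous.prod Finset.univ (fun i => M (σ i) i) (fun _ => d) fun i _ => hM _ _
  simpa using this

/-- Replacing an entry of a tuple of columns replaces the column of the submatrix. -/
theorem submatrix_update {R : Type*} (A : Matrix (Fin r) (Fin n) R) (c : Fin r → Fin n)
    (k : Fin r) (j : Fin n) :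
    A.submatrix id (Function.update c k j) = (A.submatrix id c).updateCol k (A.col j) := by
  ext a b
  by_cases h : b = k
  · subst h; simp
  · simp [h]

theorem det_submatrix_update {R : Type*} [CommRing R] (A : Matrix (Fin r) (Fin n) R)
    (c : Fin r → Fin n) (k : Fin r) (j : Fin n) :
    (A.submatrix id (Function.update c k j)).det =
      (A.submatrix id c).cramer (A.col j) k := by
  rw [submatrix_update, Matrix.cramer_apply]

/-- The matrix of coordinates `p_{c(k → j)}`, with rows `k` and columns `j`. On the minors of a
matrix `A` it specializes to `adj(A_c) A`. -/
noncomputable def exchangeMatrix (c : Fin r → Fin n) :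
    Matrix (Fin r) (Fin n) (PluckerRing F r n) :=
  Matrix.of fun k j => pluckerTuple F (Function.update c k j)

theorem map_exchangeMatrix {R : Type*} [CommRing R] [Algebra F R]
    (A : Matrix (Fin r) (Fin n) R) (c : Fin r → Fin n) :
    (exchangeMatrix F c).map (aeval (minor A)) = (A.submatrix id c).adjugate * A := by
  ext k j
  rw [Matrix.map_apply, exchangeMatrix, Matrix.of_apply, aeval_minor_pluckerTuple,
    det_submatrix_update, Matrix.cramer_eq_adjugate_mulVec]
  rfl

/-- Take determinants in `A_I adj(A_I) A_J = (det A_I) A_J`. The extra factor `det A_I` on the left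
avoids the exponent `r - 1`. -/
theorem aeval_minor_exchangeMatrix {R : Type*} [CommRing R] [Algebra F R]
    (A : Matrix (Fin r) (Fin n) R) (I J : Idx r n) :
    minor A I * aeval (minor A) (minor (exchangeMatrix F (I.1.orderEmbOfFin I.2)) J) =
      minor A I ^ r * minor A J := by
  have h : aeval (minor A) (minor (exchangeMatrix F (I.1.orderEmbOfFin I.2)) J) =
      ((A.submatrix id (I.1.orderEmbOfFin I.2)).adjugate *
        A.submatrix id (J.1.orderEmbOfFin J.2)).det := by
    rw [minor, AlgHom.map_det]
    congr 1
    have := map_exchangeMatrix F A (I.1.orderEmbOfFin I.2)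
    rw [AlgHom.mapMatrix_apply, ← Matrix.submatrix_map, this]
    rfl
  rw [h, Matrix.det_mul, ← mul_assoc]
  congr 1
  rw [minor, ← Matrix.det_mul, Matrix.mul_adjugate, Matrix.det_smul, Matrix.det_one]
  simp

/-- The Plücker relations expressing all coordinates through those of the tuples that differ from
a given `I` in at most one place. -/
theorem exchange_mem_pluckerRelations (I J : Idx r n) :
    X I * minor (exchangeMatrix F (I.1.orderEmbOfFin I.2)) J - X I ^ r * X J ∈
      pluckerRelations F r n := by
  refine ⟨⟨1 + r * 1, ?_⟩, ?_⟩
  · refine IsHomogeneous.sub ((isHomogeneous_X F I).mul (isHomogeneous_det F fun i j =>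
      isHomogeneous_pluckerTuple F _)) ?_
    have := ((isHomogeneous_X F I).pow r).mul (isHomogeneous_X F J)
    rwa [one_mul, add_comm, show 1 + r = 1 + r * 1 by rw [mul_one]] at this
  · simp only [map_sub, map_mul, map_pow, aeval_X]
    rw [aeval_minor_exchangeMatrix, sub_self]

/-- Shows that rescaling the coordinates by a nonzero scalar does not change which forms vanish at
them. -/
theorem aeval_smul_of_isHomogeneous {σ R : Type*} [CommRing R] [Algebra F R]
    {f : MvPolynomial σ F} {d : ℕ} (hf : f.IsHomogeneous d) (a : R) (p : σ → R) :
    aeval (a • p) f = a ^ d * aeval p f := by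
  rw [aeval_def, aeval_def, eval₂_eq, eval₂_eq, Finset.mul_sum]
  refine Finset.sum_congr rfl fun m hm => ?_
  have hd : ∑ i ∈ m.support, m i = d := by
    simpa [Finsupp.degree_apply] using (hf.degree_eq_sum_deg_support hm).symm
  simp only [Pi.smul_apply, smul_eq_mul, mul_pow, Finset.prod_mul_distrib,
    Finset.prod_pow_eq_pow_sum, hd]
  ring

/-- A vector of coordinates satisfying the Plücker relations, one of which is nonzero, is
proportional to the vector of maximal minors of a matrix. -/
theorem exists_matrix_minor_eq_smul {K : Type*} [Field K] [Algebra F K] (p : Idx r n → K)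
    (hp : ∀ f ∈ pluckerRelations F r n, aeval p f = 0) (I : Idx r n) (hI : p I ≠ 0) :
    ∃ A : Matrix (Fin r) (Fin n) K, minor A = (p I)⁻¹ • p := by
  -- When `p` comes from a matrix `A`, this is `adj(A_I) A / det A_I = A_I⁻¹ A`.
  refine ⟨(p I)⁻¹ • (exchangeMatrix F (I.1.orderEmbOfFin I.2)).map (aeval p), ?_⟩
  funext J
  have h := hp _ (exchange_mem_pluckerRelations F I J)
  rw [map_sub, map_mul, map_mul, map_pow, aeval_X, aeval_X, minor, AlgHom.map_det,
    sub_eq_zero] at h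
  change ((p I)⁻¹ • ((exchangeMatrix F (I.1.orderEmbOfFin I.2)).submatrix id
    (J.1.orderEmbOfFin J.2)).map (aeval p)).det = _
  rw [Matrix.det_smul, Fintype.card_fin]
  rw [AlgHom.mapMatrix_apply] at h
  rw [inv_pow, inv_mul_eq_iff_eq_mul₀ (pow_ne_zero _ hI), Pi.smul_apply, smul_eq_mul]
  refine mul_left_cancel₀ hI ?_
  rw [h]
  field_simp

theorem rank_eq_of_minor_ne_zero {K : Type*} [Field K] {A : Matrix (Fin r) (Fin n) K}
    {I : Idx r n} (hI : minor A I ≠ 0) : A.rank = r := by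
  refine le_antisymm (A.rank_le_height) ?_
  have h : (A.submatrix id (I.1.orderEmbOfFin I.2)).rank = r := by
    rw [Matrix.rank_of_isUnit _ ((Matrix.isUnit_iff_isUnit_det _).2 (isUnit_iff_ne_zero.2 hI)),
      Fintype.card_fin]
  exact h.symm.trans_le (A.rank_submatrix_le _ _)

/-- Multiplying the Cramer vector of `v` by `B` returns `det B • v`. -/
theorem eq_of_cramer_eq {K : Type*} [Field K] {m : ℕ} {B : Matrix (Fin m) (Fin m) K}
    (hB : B.det ≠ 0) {v w : Fin m → K} (h : B.cramer v = B.cramer w) : v = w := by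
  have := congrArg B.mulVec h
  rw [Matrix.mulVec_cramer, Matrix.mulVec_cramer] at this
  exact smul_right_injective _ hB this

theorem col_eq_col_iff {K : Type*} [Field K] [Algebra F K] (A : Matrix (Fin r) (Fin n) K)
    (hA : A.rank = r) (i j : Fin n) :
    A.col i = A.col j ↔ ∀ f ∈ equalColumnEquations F r i j, aeval (minor A) f = 0 := by
  constructor
  · rintro h _ ⟨c, k, rfl⟩
    rw [map_sub, aeval_minor_pluckerTuple, aeval_minor_pluckerTuple, submatrix_update,
      submatrix_update, h, sub_self]
  · intro h
    obtain ⟨I, hI⟩ := exists_minor_ne_zero A hA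
    -- Only the equations whose tuple `c` enumerates this one `I` are needed.
    refine eq_of_cramer_eq hI (funext fun k => ?_)
    have := h _ ⟨I.1.orderEmbOfFin I.2, k, rfl⟩
    rw [map_sub, aeval_minor_pluckerTuple, aeval_minor_pluckerTuple, det_submatrix_update,
      det_submatrix_update, sub_eq_zero] at this
    exact this

theorem col_eq_zero_iff {K : Type*} [Field K] [Algebra F K] (A : Matrix (Fin r) (Fin n) K)
    (hA : A.rank = r) (i : Fin n) :
    A.col i = 0 ↔ ∀ f ∈ zeroColumnEquations F r i, aeval (minor A) f = 0 := by
  constructor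
  · rintro h _ ⟨I, hi, rfl⟩
    rw [aeval_X]
    obtain ⟨k, hk⟩ : i ∈ Set.range (I.1.orderEmbOfFin I.2) := by
      rwa [Finset.range_orderEmbOfFin]
    exact Matrix.det_eq_zero_of_column_eq_zero k fun a => by
      simpa [hk] using congrFun h a
  · intro h
    obtain ⟨I, hI⟩ := exists_minor_ne_zero A hA
    refine eq_of_cramer_eq hI (funext fun k => ?_)
    -- The `k`-th Cramer coordinate is zero or, up to sign, the minor of a set containing `i`.
    rw [map_zero, ← det_submatrix_update, ← aeval_minor_pluckerTuple F, pluckerTuple]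
    split_ifs with hc
    · rw [map_zsmul, h _ ⟨_, ?_, rfl⟩]
      · simp
      · exact Finset.mem_image.2 ⟨k, Finset.mem_univ _, by simp⟩
    · simp

theorem equalColumnEquations_isHomogeneous {i j : Fin n} {f : PluckerRing F r n}
    (hf : f ∈ equalColumnEquations F r i j) : f.IsHomogeneous 1 := by
  obtain ⟨c, k, rfl⟩ := hf
  exact (isHomogeneous_pluckerTuple F _).sub (isHomogeneous_pluckerTuple F _)

theorem zeroColumnEquations_isHomogeneous {i : Fin n} {f : PluckerRing F r n}
    (hf : f ∈ zeroColumnEquations F r i) : f.IsHomogeneous 1 := by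
  obtain ⟨I, -, rfl⟩ := hf
  exact isHomogeneous_X F I

end Minors

/-! ### The Grassmannian and its open subschemes as varieties -/

theorem isReduced_subscheme_vanishingIdeal {X : Scheme.{u}} (Z : TopologicalSpace.Closeds X) :
    IsReduced (Scheme.IdealSheafData.vanishingIdeal Z).subscheme := by
  refine @IsReduced.of_openCover _
    (Scheme.IdealSheafData.vanishingIdeal Z).subschemeCover.openCover fun (U : X.affineOpens) => ?_
  -- On an affine chart the ideal is a vanishing ideal, hence radical.
  have : _root_.IsReduced (Γ(X, U.1) ⧸ (Scheme.IdealSheafData.vanishingIdeal Z).ideal U) := by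
    rw [← Ideal.isRadical_iff_quotient_reduced, Scheme.IdealSheafData.vanishingIdeal_ideal]
    exact PrimeSpectrum.isRadical_vanishingIdeal _
  exact inferInstanceAs (IsReduced (Spec (.of
    (Γ(X, U.1) ⧸ (Scheme.IdealSheafData.vanishingIdeal Z).ideal U))))

section Varieties

variable (F : Type u) [Field F] (r n : ℕ)

instance : IsReduced (Gr F r n) := isReduced_subscheme_vanishingIdeal _

instance : IsClosedImmersion (pluckerEmbedding F r n) :=
  inferInstanceAs (IsClosedImmersion
    (Scheme.IdealSheafData.vanishingIdeal (grassmannianClosed F r n)).subschemeι)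

/-- Forms of degree zero are constants. This makes the second factor of `pluckerSpaceToSpec` a
closed immersion. -/
theorem algebraMap_pluckerGrading_zero_surjective :
    Function.Surjective (algebraMap F (pluckerGrading F r n 0)) := by
  rintro ⟨f, hf⟩
  have h : f.totalDegree = 0 := (totalDegree_zero_iff_isHomogeneous _).2 hf
  refine ⟨coeff 0 f, Subtype.ext ?_⟩
  rw [totalDegree_eq_zero_iff_eq_C] at h
  exact h.symm

instance : Algebra.FiniteType (pluckerGrading F r n 0) (PluckerRing F r n) :=
  have : IsScalarTower F (pluckerGrading F r n 0) (PluckerRing F r n) :=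
    ⟨fun a b c => smul_mul_assoc a (b : PluckerRing F r n) c⟩
  Algebra.FiniteType.of_restrictScalars_finiteType F _ _

instance : IsClosedImmersion
    (Spec.map (CommRingCat.ofHom (algebraMap F (pluckerGrading F r n 0)))) :=
  IsClosedImmersion.spec_of_surjective _ (algebraMap_pluckerGrading_zero_surjective F r n)

instance : IsSeparated (pluckerSpaceToSpec F r n) := by
  unfold pluckerSpaceToSpec; infer_instance

instance : LocallyOfFiniteType (pluckerSpaceToSpec F r n) := by
  unfold pluckerSpaceToSpec; infer_instance

instance : QuasiCompact (pluckerSpaceToSpec F r n) := by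
  unfold pluckerSpaceToSpec; infer_instance

theorem isVariety_gr : IsVariety (grToSpec F r n) where
  reduced := inferInstance
  separated := by unfold grToSpec; infer_instance
  locallyOfFiniteType := by unfold grToSpec; infer_instance
  quasiCompact := by unfold grToSpec; infer_instance

end Varieties

theorem IsVariety.comp_opens_ι {F : Type u} [Field F] {X : Scheme.{u}} {f : X ⟶ Spec (.of F)}
    (hf : IsVariety f) (U : X.Opens) : IsVariety (U.ι ≫ f) := by
  obtain ⟨_, _, _, _⟩ := hf
  -- The Noetherian property makes the open immersion `U.ι` quasi-compact.
  have : IsLocallyNoetherian X := LocallyOfFiniteType.isLocallyNoetherian f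
  exact ⟨inferInstance, inferInstance, inferInstance, inferInstance⟩

/-! ### Points of the Grassmannian and representing matrices -/

section Points

variable (F : Type u) [Field F] {r n : ℕ}

theorem pluckerEmbedding_injective : Function.Injective (pluckerEmbedding F r n) :=
  (pluckerEmbedding F r n).isClosedEmbedding.injective

theorem mem_pluckerPoint_iff {K : Type v} [Field K] [Algebra F K] (A : Matrix (Fin r) (Fin n) K)
    (hA : A.rank = r) {f : PluckerRing F r n} {d : ℕ} (hf : f.IsHomogeneous d) :
    f ∈ ProjectiveSpectrum.asHomogeneousIdeal
      (pluckerPoint F A hA : ProjectiveSpectrum (pluckerGrading F r n)) ↔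
        aeval (minor A) f = 0 :=
  ⟨fun h => Ideal.toIdeal_homogeneousCore_le _ _ h,
    fun h => Ideal.mem_homogeneousCore_of_homogeneous_of_mem ⟨d, hf⟩ h⟩

theorem grPoint_mem_pluckerZeroLocus_iff {K : Type v} [Field K] [Algebra F K]
    (A : Matrix (Fin r) (Fin n) K) (hA : A.rank = r) {s : Set (PluckerRing F r n)}
    (hs : ∀ f ∈ s, ∃ d, f.IsHomogeneous d) :
    grPoint F A hA ∈ pluckerZeroLocus F r n s ↔ ∀ f ∈ s, aeval (minor A) f = 0 := by
  change s ⊆ ProjectiveSpectrum.asHomogeneousIdeal (𝒜 := pluckerGrading F r n)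
    (pluckerEmbedding F r n (grPoint F A hA)) ↔ _
  rw [pluckerEmbedding_grPoint]
  constructor
  · intro h f hf
    obtain ⟨d, hd⟩ := hs f hf
    exact (mem_pluckerPoint_iff F A hA hd).1 (h hf)
  · intro h f hf
    obtain ⟨d, hd⟩ := hs f hf
    exact (mem_pluckerPoint_iff F A hA hd).2 (h f hf)

theorem isClosed_pluckerZeroLocus (s : Set (PluckerRing F r n)) :
    IsClosed (pluckerZeroLocus F r n s) :=
  (ProjectiveSpectrum.isClosed_zeroLocus (pluckerGrading F r n) s).preimage
    (pluckerEmbedding F r n).continuous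

/-- A homogeneous ideal contains the homogeneous components of its elements, and their sum recovers
the element. -/
theorem homogeneousIdeal_eq_of_homogeneous_mem_iff {I J : HomogeneousIdeal (pluckerGrading F r n)}
    (h : ∀ (f : PluckerRing F r n) (d : ℕ), f.IsHomogeneous d → (f ∈ I ↔ f ∈ J)) : I = J := by
  have key : ∀ {I J : HomogeneousIdeal (pluckerGrading F r n)},
      (∀ (f : PluckerRing F r n) (d : ℕ), f.IsHomogeneous d → f ∈ I → f ∈ J) → I ≤ J := by
    classical
    intro I J h f hf
    rw [← DirectSum.sum_support_decompose (pluckerGrading F r n) f]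
    exact sum_mem fun d _ => h _ d
      (DirectSum.decompose (pluckerGrading F r n) f d).2 (I.isHomogeneous d hf)
  exact le_antisymm (key fun f d hd => (h f d hd).1) (key fun f d hd => (h f d hd).2)

/-- Otherwise the prime would contain the ideal generated by the variables, hence the irrelevant
ideal. -/
theorem exists_X_notMem (x : ProjectiveSpectrum (pluckerGrading F r n)) :
    ∃ I : Idx r n, (X I : PluckerRing F r n) ∉ x.asHomogeneousIdeal := by
  by_contra! h
  refine x.not_irrelevant_le fun f hf => ?_
  rw [HomogeneousIdeal.mem_irrelevant_iff] at hf
  have hf0 : coeff 0 f = 0 := by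
    have : homogeneousComponent 0 f = 0 :=
      (decomposition.decompose'_apply f 0).symm.trans hf
    rw [homogeneousComponent_zero] at this
    exact C_injective _ _ (this.trans C_0.symm)
  have hmem : f ∈ Ideal.span (X '' (Set.univ : Set (Idx r n)) : Set (PluckerRing F r n)) := by
    rw [mem_ideal_span_X_image]
    intro m hm
    by_contra! h0
    have : m = 0 := Finsupp.ext fun i => h0 i (Set.mem_univ _)
    exact mem_support_iff.1 hm (this ▸ hf0)
  refine Ideal.span_le.2 ?_ hmem
  rintro _ ⟨I, -, rfl⟩
  exact h I

/-- Every point of the Grassmannian is represented by a matrix over an extension field. -/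
theorem exists_grPoint_eq (x : Gr F r n) :
    ∃ (K : Type u) (_ : Field K) (_ : Algebra F K) (A : Matrix (Fin r) (Fin n) K)
      (hA : A.rank = r), grPoint F A hA = x := by
  let y : ProjectiveSpectrum (pluckerGrading F r n) := pluckerEmbedding F r n x
  let P : Ideal (PluckerRing F r n) := y.asHomogeneousIdeal.toIdeal
  have hP : P.IsPrime := y.isPrime
  -- This is the function field of the cone over the closure of `y`; the classes of the variables
  -- are tautological coordinates for which exactly the elements of `P` vanish.
  let K := FractionRing (PluckerRing F r n ⧸ P)
  let p : Idx r n → K := fun I => algebraMap (PluckerRing F r n) K (X I)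
  have hp : ∀ f : PluckerRing F r n, aeval p f = 0 ↔ f ∈ P := fun f => by
    have h : aeval p f = algebraMap (PluckerRing F r n) K f := by
      have : aeval p = IsScalarTower.toAlgHom F (PluckerRing F r n) K := by
        ext I; simp [p]
      rw [this]; rfl
    rw [h, IsScalarTower.algebraMap_apply (PluckerRing F r n) (PluckerRing F r n ⧸ P) K,
      FaithfulSMul.algebraMap_eq_zero_iff]
    exact Ideal.Quotient.eq_zero_iff_mem
  have hy : y ∈ (grassmannianClosed F r n : Set (pluckerSpace F r n)) := by
    have hrange :=
      (Scheme.IdealSheafData.vanishingIdeal (grassmannianClosed F r n)).range_subschemeι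
    rw [Scheme.IdealSheafData.coe_support_vanishingIdeal] at hrange
    rw [← hrange]
    exact ⟨x, rfl⟩
  obtain ⟨I, hI⟩ := exists_X_notMem F y
  have hpI : p I ≠ 0 := fun h => hI ((hp _).1 ((aeval_X p I).trans h))
  obtain ⟨A, hA⟩ := exists_matrix_minor_eq_smul F p (fun f hf => (hp f).2 (hy hf)) I hpI
  have hrank : A.rank = r := rank_eq_of_minor_ne_zero (I := I) (by simp [hA, hpI])
  refine ⟨K, inferInstance, inferInstance, A, hrank, pluckerEmbedding_injective F ?_⟩
  rw [pluckerEmbedding_grPoint]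
  refine ProjectiveSpectrum.ext (homogeneousIdeal_eq_of_homogeneous_mem_iff F fun f d hf => ?_)
  -- The minors of `A` are `p` scaled by `(p I)⁻¹`, so the same forms vanish at both.
  rw [mem_pluckerPoint_iff F A hrank hf, hA, aeval_smul_of_isHomogeneous F hf, mul_eq_zero]
  rw [or_iff_right (pow_ne_zero _ (inv_ne_zero hpI)), hp]
  rfl

/-! ### The column loci: equations, independence of the matrix, complement -/

theorem equalColumnLocus_eq (i j : Fin n) :
    equalColumnLocus F r i j = pluckerZeroLocus F r n (equalColumnEquations F r i j) := by
  have hs : ∀ f ∈ equalColumnEquations F r i j, ∃ d, f.IsHomogeneous d :=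
    fun f hf => ⟨1, equalColumnEquations_isHomogeneous F hf⟩
  ext x
  constructor
  · rintro ⟨K, _, _, A, hA, h, rfl⟩
    rwa [grPoint_mem_pluckerZeroLocus_iff F A hA hs, ← col_eq_col_iff F A hA]
  · intro h
    obtain ⟨K, _, _, A, hA, rfl⟩ := exists_grPoint_eq F x
    rw [grPoint_mem_pluckerZeroLocus_iff F A hA hs, ← col_eq_col_iff F A hA] at h
    exact ⟨K, _, _, A, hA, h, rfl⟩

theorem zeroColumnLocus_eq (i : Fin n) :
    zeroColumnLocus F r i = pluckerZeroLocus F r n (zeroColumnEquations F r i) := by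
  have hs : ∀ f ∈ zeroColumnEquations F r i, ∃ d, f.IsHomogeneous d :=
    fun f hf => ⟨1, zeroColumnEquations_isHomogeneous F hf⟩
  ext x
  constructor
  · rintro ⟨K, _, _, A, hA, h, rfl⟩
    rwa [grPoint_mem_pluckerZeroLocus_iff F A hA hs, ← col_eq_zero_iff F A hA]
  · intro h
    obtain ⟨K, _, _, A, hA, rfl⟩ := exists_grPoint_eq F x
    rw [grPoint_mem_pluckerZeroLocus_iff F A hA hs, ← col_eq_zero_iff F A hA] at h
    exact ⟨K, _, _, A, hA, h, rfl⟩

variable {K : Type v} [Field K] [Algebra F K] (A : Matrix (Fin r) (Fin n) K) (hA : A.rank = r)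

/-- The locus asks for some matrix over some field in universe `u`; its equations do not mention a
matrix, so they can be tested on the given `A` over any `K`. -/
theorem grPoint_mem_equalColumnLocus_iff (i j : Fin n) :
    grPoint F A hA ∈ equalColumnLocus F r i j ↔ A.col i = A.col j := by
  rw [equalColumnLocus_eq, grPoint_mem_pluckerZeroLocus_iff F A hA
    fun f hf => ⟨1, equalColumnEquations_isHomogeneous F hf⟩, ← col_eq_col_iff F A hA]

theorem grPoint_mem_zeroColumnLocus_iff (i : Fin n) :
    grPoint F A hA ∈ zeroColumnLocus F r i ↔ A.col i = 0 := by
  rw [zeroColumnLocus_eq, grPoint_mem_pluckerZeroLocus_iff F A hA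
    fun f hf => ⟨1, zeroColumnEquations_isHomogeneous F hf⟩, ← col_eq_zero_iff F A hA]

theorem injective_and_ne_zero_iff :
    (Function.Injective A.col ∧ ∀ i, A.col i ≠ 0) ↔
      grPoint F A hA ∉ (⋃ (i : Fin n) (j : Fin n) (_ : i ≠ j), equalColumnLocus F r i j) ∪
        ⋃ i : Fin n, zeroColumnLocus F r i := by
  simp only [Set.mem_union, Set.mem_iUnion, grPoint_mem_equalColumnLocus_iff,
    grPoint_mem_zeroColumnLocus_iff, not_or, not_exists]
  refine and_congr_left' ⟨fun h i j hij he => hij (h he), fun h i j he => ?_⟩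
  by_contra hij
  exact h i j hij he

theorem compl_distinctColumnLocus (r n : ℕ) :
    (distinctColumnLocus F r n)ᶜ =
      (⋃ (i : Fin n) (j : Fin n) (_ : i ≠ j), equalColumnLocus F r i j) ∪
        ⋃ i : Fin n, zeroColumnLocus F r i := by
  rw [compl_eq_comm]
  ext x
  constructor
  · intro h
    -- Any one representing matrix decides membership in all the loci at once.
    obtain ⟨K, _, _, A, hA, rfl⟩ := exists_grPoint_eq F x
    exact ⟨K, _, _, A, hA, (injective_and_ne_zero_iff F A hA).2 h, rfl⟩
  · rintro ⟨K, _, _, A, hA, h, rfl⟩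
    exact (injective_and_ne_zero_iff F A hA).1 h

theorem grPoint_mem_distinctColumnLocus_iff :
    grPoint F A hA ∈ distinctColumnLocus F r n ↔
      Function.Injective A.col ∧ ∀ i, A.col i ≠ 0 := by
  rw [injective_and_ne_zero_iff F A hA, ← compl_distinctColumnLocus, Set.notMem_compl_iff]

theorem isOpen_distinctColumnLocus (r n : ℕ) : IsOpen (distinctColumnLocus F r n) := by
  rw [← isClosed_compl_iff, compl_distinctColumnLocus]
  refine IsClosed.union (isClosed_iUnion_of_finite fun i => isClosed_iUnion_of_finite fun j =>
    isClosed_iUnion_of_finite fun _ => ?_) (isClosed_iUnion_of_finite fun i => ?_)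
  · exact equalColumnLocus_eq F (r := r) i j ▸ isClosed_pluckerZeroLocus F _
  · exact zeroColumnLocus_eq F (r := r) i ▸ isClosed_pluckerZeroLocus F _

end Points

end DCGrass

theorem proposition4p1 (F : Type u) [Field F] (r n : ℕ) :
    DCGrass.IsVariety (DCGrass.grToSpec F r n) ∧
    (∃ U : (DCGrass.Gr F r n).Opens,
      (U : Set (DCGrass.Gr F r n)) = DCGrass.distinctColumnLocus F r n ∧
      DCGrass.IsVariety (U.ι ≫ DCGrass.grToSpec F r n)) ∧
    (DCGrass.distinctColumnLocus F r n)ᶜ =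
      (⋃ (i : Fin n) (j : Fin n) (_ : i ≠ j), DCGrass.equalColumnLocus F r i j) ∪
        ⋃ i : Fin n, DCGrass.zeroColumnLocus F r i ∧
    (∀ i j : Fin n, i ≠ j →
      IsClosed (DCGrass.equalColumnLocus F r i j) ∧
      DCGrass.equalColumnLocus F r i j =
        DCGrass.pluckerZeroLocus F r n (DCGrass.equalColumnEquations F r i j)) ∧
    (∀ i : Fin n,
      IsClosed (DCGrass.zeroColumnLocus F r i) ∧
      DCGrass.zeroColumnLocus F r i =
        DCGrass.pluckerZeroLocus F r n (DCGrass.zeroColumnEquations F r i)) ∧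
    (∀ (K : Type v) [Field K] [Algebra F K] (A : Matrix (Fin r) (Fin n) K) (hA : A.rank = r),
      (DCGrass.grPoint F A hA ∈ DCGrass.distinctColumnLocus F r n ↔
        Function.Injective A.col ∧ ∀ i, A.col i ≠ 0) ∧
      (∀ i j : Fin n, i ≠ j →
        (DCGrass.grPoint F A hA ∈ DCGrass.equalColumnLocus F r i j ↔ A.col i = A.col j)) ∧
      (∀ i : Fin n,
        (DCGrass.grPoint F A hA ∈ DCGrass.zeroColumnLocus F r i ↔ A.col i = 0))) := by
  refine ⟨DCGrass.isVariety_gr F r n, ⟨⟨_, DCGrass.isOpen_distinctColumnLocus F r n⟩, rfl,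
    (DCGrass.isVariety_gr F r n).comp_opens_ι _⟩, DCGrass.compl_distinctColumnLocus F r n,
    fun i j _ => ⟨?_, DCGrass.equalColumnLocus_eq F i j⟩,
    fun i => ⟨?_, DCGrass.zeroColumnLocus_eq F i⟩, fun K _ _ A hA =>
    ⟨DCGrass.grPoint_mem_distinctColumnLocus_iff F A hA,
      fun i j _ => DCGrass.grPoint_mem_equalColumnLocus_iff F A hA i j,
      fun i => DCGrass.grPoint_mem_zeroColumnLocus_iff F A hA i⟩⟩
  · exact DCGrass.equalColumnLocus_eq F (r := r) i j ▸ DCGrass.isClosed_pluckerZeroLocus F _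
  · exact DCGrass.zeroColumnLocus_eq F (r := r) i ▸ DCGrass.isClosed_pluckerZeroLocus F _
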